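/- Let $n\ge 1$ be an integer. The Aztec diamond graph $AD_n$ is the subgraph of the grid graph on $(\mathbb Z+\tfrac12)^2$ (two points are adjacent if they agree in one coordinate and differ by $1$ in the other) induced by the vertices $(x,y)$ with $|x|+|y|\le n$. The quartered Aztec diamond $QAD_n$ is the subgraph of $AD_n$ induced by the vertices in its southeastern quarter, i.e. those with $x>0$ and $y<0$. Then the number of spanning trees of $QAD_n$ equals $$\prod_{1\le j<k\le n-1}\left(4-2\cos\frac{j\pi}{n}-2\cos\frac{k\pi}{n}\right),$$ where the empty product (for $n=1,2$) is $1$. -/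

import Mathlib

/-- The grid graph on `(ℤ + 1/2)²`. The pair of integers `(a, b)` stands for the point
`(a + 1/2, b + 1/2)`; two points are adjacent when they agree in one coordinate and differ
by one in the other. -/
def halfIntegerGrid : SimpleGraph (ℤ × ℤ) where
  Adj p q := (p.1 = q.1 ∧ |p.2 - q.2| = 1) ∨ (p.2 = q.2 ∧ |p.1 - q.1| = 1)
  symm := ⟨fun p q h => by
    rcases h with ⟨h1, h2⟩ | ⟨h1, h2⟩
    · exact Or.inl ⟨h1.symm, by rwa [abs_sub_comm]⟩
    · exact Or.inr ⟨h1.symm, by rwa [abs_sub_comm]⟩⟩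
  loopless := ⟨fun p h => by simp at h⟩

/-- The horizontal coordinate `x = a + 1/2` of the vertex `(a, b)`. -/
def xCoord (p : ℤ × ℤ) : ℚ := p.1 + 1 / 2

/-- The vertical coordinate `y = b + 1/2` of the vertex `(a, b)`. -/
def yCoord (p : ℤ × ℤ) : ℚ := p.2 + 1 / 2

/-- The vertices of the Aztec diamond of order `n`: the points with `|x| + |y| ≤ n`. -/
def aztecVertices (n : ℕ) : Set (ℤ × ℤ) :=
  {p | |xCoord p| + |yCoord p| ≤ n}

/-- The Aztec diamond graph `AD n`. -/
def AD (n : ℕ) : SimpleGraph (aztecVertices n) :=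
  halfIntegerGrid.induce (aztecVertices n)

/-- The vertices of the Aztec diamond in its southeastern quarter (`x > 0` and `y < 0`;
no vertex lies on a coordinate axis). -/
def southeastQuarter (n : ℕ) : Set (aztecVertices n) :=
  {p | 0 < xCoord p ∧ yCoord p < 0}

/-- The quartered Aztec diamond `QAD n`. -/
def QAD (n : ℕ) : SimpleGraph (southeastQuarter n) :=
  (AD n).induce (southeastQuarter n)

/-- The number of spanning trees of a graph on a finite vertex set. A spanning tree is given
by its edges: it is a tree on all the vertices, each of whose edges is an edge of `G`. -/
noncomputable def spanningTreeCount {V : Type*} (G : SimpleGraph V) : ℕ :=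
  Set.ncard {T : SimpleGraph V | T ≤ G ∧ T.IsTree}

/-! Spanning trees are counted through cycles rather than cuts. Let C be the matrix whose rows are
the oriented boundaries of the bounded faces. By Cauchy–Binet, det(C Cᵀ) is a sum of squared maximal
minors. Such a minor is ±1 when the edges outside the chosen columns form a spanning tree and 0
otherwise, so the determinant is the tree count (`spanningTreeCount_eq_det`).

For the quartered diamond the faces are the lattice points of the triangle 1 ≤ x < y ≤ n - 1, and C
Cᵀ is the discrete Laplacian there with zero values on the lines x = 0, x = y and y = n
(`sum_gram_boundaryMatrix_mul`). Antisymmetrized products of two sine waves vanish on these lines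
and are eigenvectors, with the factors of the claimed product as eigenvalues. They are pairwise
orthogonal and as many as the faces, so the determinant is that product (`det_gram_boundaryMatrix`).
-/

/-! ### Spanning trees and the Gram determinant of the cycle space. -/

section TreeCount

open Matrix

/-- A weak form of the Cauchy–Binet formula: the Gram determinant, multiplied by a factorial,
is the sum of the squares of all the minors, indexed by functions instead of subsets. -/
theorem factorial_mul_det_mul_transpose {F E R : Type*} [Fintype F] [DecidableEq F] [Fintype E]
    [CommRing R] (A : Matrix F E R) :
    ((Fintype.card F).factorial : R) * (A * Aᵀ).det = ∑ g : F → E, (A.submatrix id g).det ^ 2 := by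
  classical
  have h1 : (A * Aᵀ).det = ∑ g : F → E, (∏ i, A i (g i)) * (A.submatrix id g).det := by
    simp only [det_apply', mul_apply, Finset.prod_univ_sum, Finset.mul_sum,
      Fintype.piFinset_univ, transpose_apply, submatrix_apply, id]
    rw [Finset.sum_comm]
    refine Finset.sum_congr rfl fun g _ => Finset.sum_congr rfl fun σ _ => ?_
    rw [Finset.prod_mul_distrib]
    ring
  have h2 : ∀ g : F → E, (A.submatrix id g).det ^ 2 =
      ∑ σ : Equiv.Perm F, ((Equiv.Perm.sign σ : ℤ) : R) * (∏ i, A (σ i) (g i)) *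
        (A.submatrix id g).det := by
    intro g
    rw [sq, ← Finset.sum_mul]
    congr 1
    rw [det_apply']
    rfl
  simp only [h2]
  rw [Finset.sum_comm]
  -- Under g ↦ g ∘ σ the minor gains the sign of σ, which cancels the explicit one; all permutations
  -- contribute equally.
  have h3 : ∀ σ : Equiv.Perm F, ∑ g : F → E, ((Equiv.Perm.sign σ : ℤ) : R) *
      (∏ i, A (σ i) (g i)) * (A.submatrix id g).det = (A * Aᵀ).det := by
    intro σ
    rw [h1]
    refine (Fintype.sum_equiv (Equiv.arrowCongr σ.symm (Equiv.refl E)) _ _ fun g => ?_).symm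
    have h4 : (A.submatrix id (g ∘ σ)).det
        = ((Equiv.Perm.sign σ : ℤ) : R) * (A.submatrix id g).det := by
      rw [← det_permute' σ]
      rfl
    have h5 : ∏ i, A (σ i) ((g ∘ σ) i) = ∏ i, A i (g i) :=
      Equiv.prod_comp σ fun i => A i (g i)
    have h6 : ((Equiv.Perm.sign σ : ℤ) : R) * ((Equiv.Perm.sign σ : ℤ) : R) = 1 := by
      rcases Int.units_eq_one_or (Equiv.Perm.sign σ) with h | h <;> simp [h]
    change _ = _ * (∏ i, A (σ i) ((g ∘ σ) i)) * (A.submatrix id (g ∘ σ)).det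
    rw [h4, h5]
    linear_combination (-(∏ i, A i (g i)) * (A.submatrix id g).det) * h6
  simp [h3, Fintype.card_perm]

/-- The graph formed by the edges with labels in `A`. -/
def labelledGraph {V E : Type*} (src tgt : E → V) (A : Set E) : SimpleGraph V :=
  SimpleGraph.fromEdgeSet ((fun e => s(src e, tgt e)) '' A)

theorem labelledGraph_adj_of_mem {V E : Type*} {src tgt : E → V} (hloop : ∀ e, src e ≠ tgt e)
    {A : Set E} {e : E} (he : e ∈ A) : (labelledGraph src tgt A).Adj (src e) (tgt e) := by
  rw [labelledGraph, SimpleGraph.fromEdgeSet_adj]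
  exact ⟨⟨e, he, rfl⟩, hloop e⟩

theorem edgeSet_labelledGraph {V E : Type*} {src tgt : E → V} (hloop : ∀ e, src e ≠ tgt e)
    (A : Set E) : (labelledGraph src tgt A).edgeSet = (fun e => s(src e, tgt e)) '' A := by
  rw [labelledGraph, SimpleGraph.edgeSet_fromEdgeSet, sdiff_eq_left, Set.disjoint_left]
  rintro _ ⟨e, _, rfl⟩ h
  exact hloop e (by simpa using h)

/-- A circulation supported on an acyclic graph vanishes. -/
theorem circulation_eq_zero {V E R : Type*} [Fintype E] [CommRing R]
    {src tgt : E → V} (hloop : ∀ e, src e ≠ tgt e)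
    (hinj : Function.Injective fun e => s(src e, tgt e)) (w : E → R)
    (hw : ∀ φ : V → ℤ, ∑ e, w e * ((φ (tgt e) - φ (src e) : ℤ) : R) = 0) {A : Set E}
    (hA : (labelledGraph src tgt A).IsAcyclic) (hwA : ∀ e ∉ A, w e = 0) (e : E) : w e = 0 := by
  classical
  by_cases he : e ∈ A
  swap
  · exact hwA e he
  have hbr := SimpleGraph.isAcyclic_iff_forall_adj_isBridge.1 hA (labelledGraph_adj_of_mem hloop he)
  rw [SimpleGraph.isBridge_iff] at hbr
  set H := (labelledGraph src tgt A).deleteEdges {s(src e, tgt e)} with hH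
  -- Test against the indicator of the side of the bridge e containing `src e`: no other edge of A
  -- crosses this cut, so only the term of e survives.
  have key := hw fun v => if H.Reachable (src e) v then 1 else 0
  rw [Finset.sum_eq_single e] at key
  · simpa [hbr] using key
  · intro e' _ hne
    by_cases he' : e' ∈ A
    · have hadj : H.Adj (src e') (tgt e') := by
        rw [hH, SimpleGraph.deleteEdges_adj]
        exact ⟨labelledGraph_adj_of_mem hloop he', fun h => hne (hinj h)⟩
      have hiff : H.Reachable (src e) (tgt e') ↔ H.Reachable (src e) (src e') :=
        ⟨fun h => h.trans hadj.symm.reachable, fun h => h.trans hadj.reachable⟩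
      simp [hiff]
    · simp [hwA e' he']
  · simp

/-- A function that is constant along the edges of a connected graph is constant. -/
theorem SimpleGraph.Reachable.apply_eq {V α : Type*} {G : SimpleGraph V} {φ : V → α}
    (h : ∀ u v, G.Adj u v → φ u = φ v) {u v : V} (huv : G.Reachable u v) : φ u = φ v := by
  obtain ⟨p⟩ := huv
  induction p with
  | nil => rfl
  | cons hadj _ ih => exact (h _ _ hadj).trans ih

section

variable {V E F : Type*} [Fintype E] [Fintype F] [DecidableEq F]
  {G : SimpleGraph V} {src tgt : E → V} {C : Matrix F E ℤ}

/-- The coboundary of the indicator of one component vanishes off the range of g, and C kills it, so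
its restriction to the chosen columns is a kernel vector. That vector is nonzero because G is
connected. -/
theorem det_submatrix_eq_zero_of_not_connected (hG : G.Connected)
    (hadj : ∀ u v, G.Adj u v → ∃ e, s(src e, tgt e) = s(u, v)) (hloop : ∀ e, src e ≠ tgt e)
    (hC : ∀ f, ∀ φ : V → ℤ, ∑ e, C f e * (φ (tgt e) - φ (src e)) = 0)
    {g : F → E} (hg : Function.Injective g)
    (hT : ¬ (labelledGraph src tgt (Set.range g)ᶜ).Connected) :
    (C.submatrix id g).det = 0 := by
  classical
  have := hG.nonempty
  set T := labelledGraph src tgt (Set.range g)ᶜ with hTdef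
  obtain ⟨u, v, huv⟩ : ∃ u v, ¬ T.Reachable u v := by
    by_contra! h
    exact hT ⟨h⟩
  let φ : V → ℤ := fun x => if T.Reachable u x then 1 else 0
  have hφ : ∀ e, e ∉ Set.range g → φ (tgt e) - φ (src e) = 0 := by
    intro e he
    have ha : T.Adj (src e) (tgt e) := labelledGraph_adj_of_mem hloop he
    have hiff : T.Reachable u (tgt e) ↔ T.Reachable u (src e) :=
      ⟨fun h => h.trans ha.symm.reachable, fun h => h.trans ha.reachable⟩
    simp [φ, hiff]
  rw [← exists_mulVec_eq_zero_iff]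
  refine ⟨fun i => φ (tgt (g i)) - φ (src (g i)), ?_, ?_⟩
  · intro h0
    have hall : ∀ e, φ (tgt e) - φ (src e) = 0 := by
      intro e
      by_cases he : e ∈ Set.range g
      · obtain ⟨i, rfl⟩ := he
        exact congrFun h0 i
      · exact hφ e he
    have hconst : φ u = φ v := by
      refine SimpleGraph.Reachable.apply_eq (G := G) ?_ (hG.preconnected u v)
      intro x y hxy
      obtain ⟨e, he⟩ := hadj x y hxy
      have := hall e
      rw [Sym2.eq_iff] at he
      rcases he with ⟨rfl, rfl⟩ | ⟨rfl, rfl⟩ <;> lia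
    simp [φ, huv] at hconst
  · funext f
    refine Eq.trans ?_ (hC f φ)
    refine Fintype.sum_of_injective g hg _ _ (fun e he => ?_) fun i => rfl
    rw [hφ e he, mul_zero]

/-- If a prime p divided the minor, some nonzero combination of rows mod p would vanish on the
chosen columns. It would be a circulation mod p supported on a forest, hence zero, against the
independence of the rows mod p. Independence modulo every prime is what forces ±1 rather than merely
a nonzero value. -/
theorem isUnit_det_submatrix_of_isAcyclic (hloop : ∀ e, src e ≠ tgt e)
    (hinj : Function.Injective fun e => s(src e, tgt e))
    (hC : ∀ f, ∀ φ : V → ℤ, ∑ e, C f e * (φ (tgt e) - φ (src e)) = 0)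
    (hrow : ∀ p : ℕ, p.Prime → ∀ c : F → ZMod p, (∀ e, ∑ f, c f * (C f e : ZMod p) = 0) → c = 0)
    {g : F → E} (hT : (labelledGraph src tgt (Set.range g)ᶜ).IsAcyclic) :
    IsUnit (C.submatrix id g).det := by
  classical
  rw [Int.isUnit_iff_natAbs_eq]
  by_contra hne
  obtain ⟨p, hp, hdvd⟩ := Nat.exists_prime_and_dvd hne
  have : Fact p.Prime := ⟨hp⟩
  have hdet : ((C.submatrix id g).map (Int.cast : ℤ → ZMod p)).det = 0 := by
    have h := (Int.castRingHom (ZMod p)).map_det (C.submatrix id g)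
    have h0 : (((C.submatrix id g).det : ℤ) : ZMod p) = 0 := by
      rw [ZMod.intCast_zmod_eq_zero_iff_dvd]
      exact Int.natCast_dvd.2 hdvd
    exact h.symm.trans h0
  rw [← exists_vecMul_eq_zero_iff] at hdet
  obtain ⟨c, hc0, hc⟩ := hdet
  refine hc0 (hrow p hp c ?_)
  refine circulation_eq_zero hloop hinj (fun e => ∑ f, c f * (C f e : ZMod p)) ?_ hT ?_
  · intro φ
    simp only [Finset.sum_mul]
    rw [Finset.sum_comm]
    refine Finset.sum_eq_zero fun f _ => ?_
    have h := congrArg (Int.cast : ℤ → ZMod p) (hC f φ)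
    push_cast at h
    simp only [mul_assoc, ← Finset.mul_sum]
    push_cast
    rw [h, mul_zero]
  · intro e he
    obtain ⟨i, rfl⟩ : e ∈ Set.range g := by simpa using he
    exact congrFun hc i

/-- For injective g, `hcard` leaves exactly |V| - 1 edges in the complement, so connectedness
already makes it a tree and the two preceding cases are exhaustive. -/
theorem sq_det_submatrix [Fintype V] [DecidableEq E] (hG : G.Connected)
    (hadj : ∀ u v, G.Adj u v → ∃ e, s(src e, tgt e) = s(u, v)) (hloop : ∀ e, src e ≠ tgt e)
    (hinj : Function.Injective fun e => s(src e, tgt e))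
    (hcard : Fintype.card F + Fintype.card V = Fintype.card E + 1)
    (hC : ∀ f, ∀ φ : V → ℤ, ∑ e, C f e * (φ (tgt e) - φ (src e)) = 0)
    (hrow : ∀ p : ℕ, p.Prime → ∀ c : F → ZMod p, (∀ e, ∑ f, c f * (C f e : ZMod p) = 0) → c = 0)
    (g : F → E) [Decidable (Function.Injective g ∧
      (labelledGraph src tgt (Set.range g)ᶜ).IsTree)] :
    (C.submatrix id g).det ^ 2 =
      if Function.Injective g ∧ (labelledGraph src tgt (Set.range g)ᶜ).IsTree then 1 else 0 := by
  split_ifs with h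
  · exact Int.isUnit_sq (isUnit_det_submatrix_of_isAcyclic hloop hinj hC hrow h.2.isAcyclic)
  · rw [sq_eq_zero_iff]
    by_cases hg : Function.Injective g
    · refine det_submatrix_eq_zero_of_not_connected hG hadj hloop hC hg fun hconn => h ⟨hg, ?_⟩
      rw [SimpleGraph.isTree_iff_connected_and_card]
      refine ⟨hconn, ?_⟩
      rw [edgeSet_labelledGraph hloop, Nat.card_image_of_injective hinj, Nat.card_coe_set_eq,
        Set.ncard_compl, ← Set.image_univ, Set.ncard_image_of_injective _ hg, Set.ncard_univ,
        Nat.card_eq_fintype_card, Nat.card_eq_fintype_card, Nat.card_eq_fintype_card]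
      have := Fintype.card_le_of_injective g hg
      omega
    · obtain ⟨i, j, hij, hne⟩ : ∃ i j, g i = g j ∧ i ≠ j := by
        simpa [Function.Injective] using hg
      exact det_zero_of_column_eq hne fun k => by simp [hij]

end

/-- The number of functions with a given image of the largest possible size. -/
theorem card_filter_image_eq {F E : Type*} [Fintype F] [DecidableEq F] [Fintype E] [DecidableEq E]
    (S : Finset E) (hS : S.card = Fintype.card F) :
    (Finset.univ.filter fun g : F → E => Finset.univ.image g = S).card =
      (Fintype.card F).factorial := by
  have hcard : Fintype.card F = Fintype.card S := by simp [hS]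
  rw [← Fintype.card_equiv (Fintype.equivOfCardEq hcard), ← Finset.card_univ]
  symm
  refine Finset.card_bij (fun σ _ => fun i => (σ i : E)) ?_ ?_ ?_
  · intro σ _
    simp only [Finset.mem_filter, Finset.mem_univ, true_and]
    ext e
    simp only [Finset.mem_image, Finset.mem_univ, true_and]
    constructor
    · rintro ⟨i, rfl⟩
      exact (σ i).2
    · intro he
      exact ⟨σ.symm ⟨e, he⟩, by simp⟩
  · intro σ _ τ _ h
    ext i
    exact congrFun h i
  · intro g hg
    simp only [Finset.mem_filter, Finset.mem_univ, true_and] at hg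
    have hmem : ∀ i, g i ∈ S := fun i => hg ▸ Finset.mem_image_of_mem g (Finset.mem_univ i)
    have hsurj : Function.Surjective fun i => (⟨g i, hmem i⟩ : S) := by
      rintro ⟨e, he⟩
      rw [← hg] at he
      obtain ⟨i, -, rfl⟩ := Finset.mem_image.1 he
      exact ⟨i, rfl⟩
    exact ⟨Equiv.ofBijective _ ((Fintype.bijective_iff_surjective_and_card _).2 ⟨hsurj, hcard⟩),
      Finset.mem_univ _, rfl⟩

/-- The number of spanning trees is the number of edge sets whose complement is a tree. -/
theorem spanningTreeCount_eq_card {V E : Type*} [Fintype V] [Fintype E] [DecidableEq E]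
    {G : SimpleGraph V} {src tgt : E → V}
    (hadj : ∀ u v, G.Adj u v ↔ ∃ e, s(src e, tgt e) = s(u, v)) (hloop : ∀ e, src e ≠ tgt e)
    (hinj : Function.Injective fun e => s(src e, tgt e))
    [DecidablePred fun S : Finset E => (labelledGraph src tgt (S : Set E)ᶜ).IsTree] :
    spanningTreeCount G =
      (Finset.univ.filter fun S : Finset E => (labelledGraph src tgt (S : Set E)ᶜ).IsTree).card := by
  have hset : {T : SimpleGraph V | T ≤ G ∧ T.IsTree} =
      (fun S : Finset E => labelledGraph src tgt (S : Set E)ᶜ) ''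
        (Finset.univ.filter fun S : Finset E =>
          (labelledGraph src tgt (S : Set E)ᶜ).IsTree : Finset (Finset E)) := by
    ext T
    simp only [Set.mem_ofPred_eq, Set.mem_image, Finset.coe_filter, Finset.mem_univ, true_and]
    constructor
    · rintro ⟨hle, hT⟩
      have heq : labelledGraph src tgt
          ((Set.toFinite {e | ¬ T.Adj (src e) (tgt e)}).toFinset : Set E)ᶜ = T := by
        rw [← SimpleGraph.edgeSet_inj, edgeSet_labelledGraph hloop]
        ext z
        induction z with | _ u v
        simp only [Set.mem_image, Set.mem_compl_iff, Set.Finite.coe_toFinset, Set.mem_ofPred_eq,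
          not_not, SimpleGraph.mem_edgeSet]
        constructor
        · rintro ⟨e, he, hs⟩
          rw [← SimpleGraph.mem_edgeSet, ← hs]
          exact he
        · intro huv
          obtain ⟨e, he⟩ := (hadj u v).1 (hle huv)
          refine ⟨e, ?_, he⟩
          rw [← SimpleGraph.mem_edgeSet, he]
          exact huv
      exact ⟨_, by rw [heq]; exact hT, heq⟩
    · rintro ⟨S, hS, rfl⟩
      refine ⟨?_, hS⟩
      rw [← SimpleGraph.edgeSet_subset_edgeSet, edgeSet_labelledGraph hloop]
      rintro _ ⟨e, _, rfl⟩
      exact (hadj _ _).2 ⟨e, rfl⟩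
  rw [spanningTreeCount, hset, Set.InjOn.ncard_image, Set.ncard_coe_finset]
  intro S _ S' _ h
  have h' := congrArg SimpleGraph.edgeSet h
  simp only [edgeSet_labelledGraph hloop] at h'
  exact Finset.coe_injective (compl_injective (hinj.image_injective h'))

/-- The number of spanning trees is the Gram determinant of an integral basis of the cycle
space. -/
theorem spanningTreeCount_eq_det {V E F : Type*} [Fintype V] [Fintype E] [Fintype F]
    [DecidableEq F] {G : SimpleGraph V} {src tgt : E → V} {C : Matrix F E ℤ} (hG : G.Connected)
    (hadj : ∀ u v, G.Adj u v ↔ ∃ e, s(src e, tgt e) = s(u, v)) (hloop : ∀ e, src e ≠ tgt e)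
    (hinj : Function.Injective fun e => s(src e, tgt e))
    (hcard : Fintype.card F + Fintype.card V = Fintype.card E + 1)
    (hC : ∀ f, ∀ φ : V → ℤ, ∑ e, C f e * (φ (tgt e) - φ (src e)) = 0)
    (hrow : ∀ p : ℕ, p.Prime → ∀ c : F → ZMod p,
      (∀ e, ∑ f, c f * (C f e : ZMod p) = 0) → c = 0) :
    (spanningTreeCount G : ℤ) = (C * Cᵀ).det := by
  classical
  have hf : ((Fintype.card F).factorial : ℤ) ≠ 0 := by exact_mod_cast Nat.factorial_ne_zero _
  refine mul_left_cancel₀ hf ?_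
  rw [factorial_mul_det_mul_transpose,
    Finset.sum_congr rfl fun g _ =>
      sq_det_submatrix hG (fun u v h => (hadj u v).1 h) hloop hinj hcard hC hrow g,
    Finset.sum_boole, spanningTreeCount_eq_card hadj hloop hinj,
    ← Nat.cast_mul, Nat.cast_inj]
  set 𝒯 := Finset.univ.filter fun S : Finset E => (labelledGraph src tgt (S : Set E)ᶜ).IsTree
  have hsize : ∀ S ∈ 𝒯, S.card = Fintype.card F := by
    intro S hS
    have hT := (SimpleGraph.isTree_iff_connected_and_card.1 (Finset.mem_filter.1 hS).2).2
    rw [edgeSet_labelledGraph hloop, Nat.card_image_of_injective hinj, Nat.card_coe_set_eq,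
      Set.ncard_compl, Set.ncard_coe_finset, Nat.card_eq_fintype_card,
      Nat.card_eq_fintype_card] at hT
    have := Finset.card_le_univ S
    omega
  have hmaps : ∀ g ∈ Finset.univ.filter fun g : F → E =>
      Function.Injective g ∧ (labelledGraph src tgt (Set.range g)ᶜ).IsTree,
      Finset.univ.image g ∈ 𝒯 := by
    intro g hg
    simpa [𝒯] using (Finset.mem_filter.1 hg).2.2
  -- Grouping the functions g by image, each admissible edge set arises |F|! times, which matches
  -- the factorial from Cauchy–Binet.
  rw [Finset.card_eq_sum_card_fiberwise hmaps, mul_comm]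
  symm
  refine Finset.sum_const_nat fun S hS => ?_
  rw [← card_filter_image_eq S (hsize S hS)]
  congr 1
  ext g
  simp only [Finset.mem_filter, Finset.mem_univ, true_and, and_iff_right_iff_imp]
  rintro rfl
  refine ⟨?_, by simpa [𝒯] using hS⟩
  rw [← Set.injOn_univ, ← Finset.coe_univ, ← Finset.card_image_iff, hsize _ hS, Finset.card_univ]

end TreeCount

/-! ### Integer coordinates for the vertices, edges and faces of the quartered diamond. -/

section Quarter

open Matrix

/-- The vertices of `QAD n`, with the vertical index shifted by `n`. -/
noncomputable def vertexSet (n : ℕ) : Finset (ℤ × ℤ) :=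
  (Finset.Icc 0 ((n : ℤ) - 1) ×ˢ Finset.Icc 0 ((n : ℤ) - 1)).filter fun p => p.1 ≤ p.2

/-- The horizontal edges, labelled by their right endpoints. -/
noncomputable def horizontalSet (n : ℕ) : Finset (ℤ × ℤ) :=
  (Finset.Icc 1 ((n : ℤ) - 1) ×ˢ Finset.Icc 1 ((n : ℤ) - 1)).filter fun p => p.1 ≤ p.2

/-- The vertical edges, labelled by their upper endpoints. -/
noncomputable def verticalSet (n : ℕ) : Finset (ℤ × ℤ) :=
  (Finset.Icc 0 ((n : ℤ) - 1) ×ˢ Finset.Icc 0 ((n : ℤ) - 1)).filter fun p => p.1 < p.2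

/-- The bounded faces, labelled by their upper right corners. -/
noncomputable def faceSet (n : ℕ) : Finset (ℤ × ℤ) :=
  (Finset.Icc 1 ((n : ℤ) - 1) ×ˢ Finset.Icc 1 ((n : ℤ) - 1)).filter fun p => p.1 < p.2

theorem mem_vertexSet {n : ℕ} {p : ℤ × ℤ} :
    p ∈ vertexSet n ↔ 0 ≤ p.1 ∧ p.1 ≤ p.2 ∧ p.2 ≤ n - 1 := by
  simp only [vertexSet, Finset.mem_filter, Finset.mem_product, Finset.mem_Icc]
  omega

theorem mem_horizontalSet {n : ℕ} {p : ℤ × ℤ} :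
    p ∈ horizontalSet n ↔ 1 ≤ p.1 ∧ p.1 ≤ p.2 ∧ p.2 ≤ n - 1 := by
  simp only [horizontalSet, Finset.mem_filter, Finset.mem_product, Finset.mem_Icc]
  omega

theorem mem_verticalSet {n : ℕ} {p : ℤ × ℤ} :
    p ∈ verticalSet n ↔ 0 ≤ p.1 ∧ p.1 < p.2 ∧ p.2 ≤ n - 1 := by
  simp only [verticalSet, Finset.mem_filter, Finset.mem_product, Finset.mem_Icc]
  omega

theorem mem_faceSet {n : ℕ} {p : ℤ × ℤ} :
    p ∈ faceSet n ↔ 1 ≤ p.1 ∧ p.1 < p.2 ∧ p.2 ≤ n - 1 := by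
  simp only [faceSet, Finset.mem_filter, Finset.mem_product, Finset.mem_Icc]
  omega

theorem mem_quarter_iff {n : ℕ} {p : ℤ × ℤ} :
    (p ∈ aztecVertices n ∧ 0 < xCoord p ∧ yCoord p < 0) ↔
      0 ≤ p.1 ∧ p.2 ≤ -1 ∧ p.1 - p.2 ≤ n := by
  obtain ⟨a, b⟩ := p
  simp only [aztecVertices, xCoord, yCoord, Set.mem_ofPred_eq]
  have ha : 0 < (a : ℚ) + 1 / 2 ↔ 0 ≤ a := by
    constructor
    · intro h
      have : (-1 : ℚ) < a := by linarith
      have : (-1 : ℤ) < a := by exact_mod_cast this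
      omega
    · intro h
      have : (0 : ℚ) ≤ a := by exact_mod_cast h
      linarith
  have hb : (b : ℚ) + 1 / 2 < 0 ↔ b ≤ -1 := by
    constructor
    · intro h
      have : (b : ℚ) < 0 := by linarith
      have : b < 0 := by exact_mod_cast this
      omega
    · intro h
      have : (b : ℚ) ≤ -1 := by exact_mod_cast h
      linarith
  rw [ha, hb]
  constructor
  · rintro ⟨h, h1, h2⟩
    refine ⟨h1, h2, ?_⟩
    rw [abs_of_pos (ha.2 h1), abs_of_neg (hb.2 h2)] at h
    have : (a : ℚ) - b ≤ n := by linarith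
    exact_mod_cast this
  · rintro ⟨h1, h2, h⟩
    refine ⟨?_, h1, h2⟩
    rw [abs_of_pos (ha.2 h1), abs_of_neg (hb.2 h2)]
    have : (a : ℚ) - b ≤ n := by exact_mod_cast h
    linarith

/-- The labelling of the vertices of `QAD n`. -/
def vertexEquiv (n : ℕ) : vertexSet n ≃ southeastQuarter n where
  toFun p :=
    have h := mem_quarter_iff.2 (show 0 ≤ (p.1.1, p.1.2 - (n : ℤ)).1 ∧ _ by
      have := mem_vertexSet.1 p.2
      dsimp only
      omega)
    ⟨⟨(p.1.1, p.1.2 - n), h.1⟩, h.2⟩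
  invFun q := ⟨(q.1.1.1, q.1.1.2 + n), by
    have := mem_quarter_iff.1 ⟨q.1.2, q.2⟩
    rw [mem_vertexSet]
    dsimp only
    omega⟩
  left_inv p := by simp
  right_inv q := by simp

theorem adj_vertexEquiv_iff {n : ℕ} (p q : vertexSet n) :
    (QAD n).Adj (vertexEquiv n p) (vertexEquiv n q) ↔
      (p.1.1 = q.1.1 ∧ |p.1.2 - q.1.2| = 1) ∨ (p.1.2 = q.1.2 ∧ |p.1.1 - q.1.1| = 1) := by
  change (p.1.1 = q.1.1 ∧ |(p.1.2 - (n : ℤ)) - (q.1.2 - n)| = 1) ∨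
    (p.1.2 - (n : ℤ) = q.1.2 - n ∧ |p.1.1 - q.1.1| = 1) ↔ _
  rw [sub_sub_sub_cancel_right, sub_left_inj]

/-- The left or lower endpoint of an edge. -/
def edgeSrc (n : ℕ) : horizontalSet n ⊕ verticalSet n → vertexSet n :=
  Sum.elim
    (fun e => ⟨(e.1.1 - 1, e.1.2), by
      have := mem_horizontalSet.1 e.2
      rw [mem_vertexSet]
      dsimp only
      omega⟩)
    (fun e => ⟨(e.1.1, e.1.2 - 1), by
      have := mem_verticalSet.1 e.2
      rw [mem_vertexSet]
      dsimp only
      omega⟩)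

/-- The right or upper endpoint of an edge. -/
def edgeTgt (n : ℕ) : horizontalSet n ⊕ verticalSet n → vertexSet n :=
  Sum.elim
    (fun e => ⟨e.1, by
      have := mem_horizontalSet.1 e.2
      rw [mem_vertexSet]
      omega⟩)
    (fun e => ⟨e.1, by
      have := mem_verticalSet.1 e.2
      rw [mem_vertexSet]
      omega⟩)

theorem edgeSrc_ne_edgeTgt {n : ℕ} (e) : edgeSrc n e ≠ edgeTgt n e := by
  rcases e with e | e <;> simp [edgeSrc, edgeTgt, Subtype.ext_iff, Prod.ext_iff]

theorem edge_injective (n : ℕ) : Function.Injective fun e => s(edgeSrc n e, edgeTgt n e) := by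
  rintro (⟨⟨a, b⟩, h⟩ | ⟨⟨a, b⟩, h⟩) (⟨⟨c, d⟩, h'⟩ | ⟨⟨c, d⟩, h'⟩) heq <;>
    simp only [edgeSrc, edgeTgt, Sum.elim_inl, Sum.elim_inr, Sym2.eq_iff, Subtype.mk.injEq,
      Prod.mk.injEq] at heq <;>
    simp only [Sum.inl.injEq, Sum.inr.injEq, Subtype.mk.injEq, Prod.mk.injEq, reduceCtorEq] <;>
    omega

theorem adj_iff_exists_edge {n : ℕ} (p q : vertexSet n) :
    (QAD n).Adj (vertexEquiv n p) (vertexEquiv n q) ↔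
      ∃ e, s(edgeSrc n e, edgeTgt n e) = s(p, q) := by
  rw [adj_vertexEquiv_iff]
  obtain ⟨⟨a, b⟩, hp⟩ := p
  obtain ⟨⟨c, d⟩, hq⟩ := q
  have hp' := mem_vertexSet.1 hp
  have hq' := mem_vertexSet.1 hq
  simp only [Sum.exists, edgeSrc, edgeTgt, Sum.elim_inl, Sum.elim_inr, Sym2.eq_iff,
    Subtype.mk.injEq, Subtype.exists, Prod.exists, Prod.mk.injEq, mem_horizontalSet,
    mem_verticalSet] at hp' hq' ⊢
  constructor
  · rintro (⟨rfl, h⟩ | ⟨rfl, h⟩)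
    · rcases (abs_eq zero_le_one).1 h with h | h
      · exact Or.inr ⟨a, b, by omega, by omega⟩
      · exact Or.inr ⟨a, d, by omega, by omega⟩
    · rcases (abs_eq zero_le_one).1 h with h | h
      · exact Or.inl ⟨a, b, by omega, by omega⟩
      · exact Or.inl ⟨c, b, by omega, by omega⟩
  · rintro (⟨x, y, h, h'⟩ | ⟨x, y, h, h'⟩)
    · right
      rw [abs_eq zero_le_one]
      omega
    · left
      rw [abs_eq zero_le_one]
      omega

/-- Moving left to column 0 and then up to the corner (0, n - 1) never leaves the region 0 ≤ a ≤ b ≤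
n - 1. -/
theorem QAD_connected {n : ℕ} (hn : 1 ≤ n) : (QAD n).Connected := by
  have hcorner : (0, (n : ℤ) - 1) ∈ vertexSet n := by
    rw [mem_vertexSet]
    dsimp only
    omega
  have hup : ∀ k : ℕ, ∀ b : ℤ, b = n - 1 - k → ∀ h : (0, b) ∈ vertexSet n,
      (QAD n).Reachable (vertexEquiv n ⟨_, h⟩) (vertexEquiv n ⟨_, hcorner⟩) := by
    intro k
    induction k with
    | zero =>
      rintro b hb h
      obtain rfl : b = n - 1 := by simpa using hb
      rfl
    | succ k ih =>
      intro b hb h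
      have h1 : (0, b + 1) ∈ vertexSet n := by
        rw [mem_vertexSet] at h ⊢
        dsimp only at h ⊢
        omega
      refine SimpleGraph.Reachable.trans (SimpleGraph.Adj.reachable ?_) (ih (b + 1) (by lia) h1)
      rw [adj_vertexEquiv_iff]
      simp
  have hleft : ∀ k : ℕ, ∀ b : ℤ, ∀ h : ((k : ℤ), b) ∈ vertexSet n,
      (QAD n).Reachable (vertexEquiv n ⟨_, h⟩) (vertexEquiv n ⟨_, hcorner⟩) := by
    intro k
    induction k with
    | zero =>
      intro b h
      have h' := mem_vertexSet.1 h
      exact hup (n - 1 - b).toNat b (by dsimp only at h'; omega) h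
    | succ k ih =>
      intro b h
      have h1 : ((k : ℤ), b) ∈ vertexSet n := by
        rw [mem_vertexSet] at h ⊢
        dsimp only at h ⊢
        omega
      refine SimpleGraph.Reachable.trans (SimpleGraph.Adj.reachable ?_) (ih b h1)
      rw [adj_vertexEquiv_iff]
      simp
  have hall : ∀ v, (QAD n).Reachable v (vertexEquiv n ⟨_, hcorner⟩) := by
    intro v
    obtain ⟨⟨⟨a, b⟩, h⟩, rfl⟩ := (vertexEquiv n).surjective v
    have h' := mem_vertexSet.1 h
    lift a to ℕ using h'.1
    exact hleft a b h
  have : Nonempty (southeastQuarter n) := ⟨vertexEquiv n ⟨_, hcorner⟩⟩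
  exact ⟨fun u v => (hall u).trans (hall v).symm⟩

/-- Euler's relation. Deleting column 0 turns vertex labels into horizontal edge labels and vertical
edge labels into face labels; the deleted columns have n and n - 1 elements. -/
theorem card_faceSet_add_card_vertexSet {n : ℕ} (hn : 1 ≤ n) :
    (faceSet n).card + (vertexSet n).card =
      (horizontalSet n).card + (verticalSet n).card + 1 := by
  have h1 : vertexSet n = horizontalSet n ∪ {0} ×ˢ Finset.Icc 0 ((n : ℤ) - 1) := by
    ext ⟨a, b⟩
    simp only [Finset.mem_union, mem_vertexSet, mem_horizontalSet, Finset.mem_product,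
      Finset.mem_singleton, Finset.mem_Icc]
    omega
  have h2 : verticalSet n = faceSet n ∪ {0} ×ˢ Finset.Icc 1 ((n : ℤ) - 1) := by
    ext ⟨a, b⟩
    simp only [Finset.mem_union, mem_verticalSet, mem_faceSet, Finset.mem_product,
      Finset.mem_singleton, Finset.mem_Icc]
    omega
  rw [h1, h2, Finset.card_union_of_disjoint, Finset.card_union_of_disjoint,
    Finset.card_product, Finset.card_product, Int.card_Icc, Int.card_Icc,
    Finset.card_singleton]
  · omega
  · rw [Finset.disjoint_left]
    rintro ⟨a, b⟩
    simp only [mem_faceSet, Finset.mem_product, Finset.mem_singleton, Finset.mem_Icc]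
    omega
  · rw [Finset.disjoint_left]
    rintro ⟨a, b⟩
    simp only [mem_horizontalSet, Finset.mem_product, Finset.mem_singleton, Finset.mem_Icc]
    omega

/-! ### The face boundary matrix, its Gram matrix and its rank. -/

/-- The matrix whose rows are the boundaries of the faces. -/
def boundaryMatrix (n : ℕ) : Matrix (faceSet n) (horizontalSet n ⊕ verticalSet n) ℤ :=
  fun f => Sum.elim
    -- Counterclockwise orientation: the bottom and right sides count +1, the top and left sides -1.
    (fun e => (if f.1 = (e.1.1, e.1.2 + 1) then 1 else 0) - if f.1 = e.1 then 1 else 0)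
    (fun e => (if f.1 = e.1 then 1 else 0) - if f.1 = (e.1.1 + 1, e.1.2) then 1 else 0)

theorem sum_coe_ite_eq_mul {α R : Type*} [DecidableEq α] [CommRing R] (S : Finset α) (q : α)
    (v : α → R) :
    ∑ f : S, (if f.1 = q then 1 else 0) * v f.1 = if q ∈ S then v q else 0 := by
  rw [Finset.sum_coe_sort S fun f => (if f = q then 1 else 0) * v f]
  simp

theorem sum_boundaryMatrix_mul {n : ℕ} {R : Type*} [CommRing R] (f : faceSet n)
    (wh wv : ℤ × ℤ → R) :
    ∑ e, (boundaryMatrix n f e : R) * Sum.elim (fun e => wh e.1) (fun e => wv e.1) e =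
      wh (f.1.1, f.1.2 - 1) - wh f.1 + (wv f.1 - wv (f.1.1 - 1, f.1.2)) := by
  obtain ⟨⟨x, y⟩, hf⟩ := f
  have hf' := mem_faceSet.1 hf
  dsimp only at hf'
  have e1 : ∀ p : ℤ × ℤ, (x, y) = (p.1, p.2 + 1) ↔ p = (x, y - 1) := by
    rintro ⟨a, b⟩
    simp only [Prod.mk.injEq]
    omega
  have e2 : ∀ p : ℤ × ℤ, (x, y) = (p.1 + 1, p.2) ↔ p = (x - 1, y) := by
    rintro ⟨a, b⟩
    simp only [Prod.mk.injEq]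
    omega
  have m1 : (x, y - 1) ∈ horizontalSet n := by rw [mem_horizontalSet]; dsimp only; omega
  have m2 : (x, y) ∈ horizontalSet n := by rw [mem_horizontalSet]; dsimp only; omega
  have m3 : (x, y) ∈ verticalSet n := by rw [mem_verticalSet]; dsimp only; omega
  have m4 : (x - 1, y) ∈ verticalSet n := by rw [mem_verticalSet]; dsimp only; omega
  rw [Fintype.sum_sum_type]
  simp only [boundaryMatrix, Sum.elim_inl, Sum.elim_inr, e1, e2, eq_comm (a := (x, y))]
  push_cast
  simp only [sub_mul, Finset.sum_sub_distrib, sum_coe_ite_eq_mul, m1, m2, m3, m4, if_true]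

/-- Each edge sees the faces on its two sides. Requiring v to vanish on the rim of the triangle lets
one formula cover the edges that border the outer face. -/
theorem sum_mul_boundaryMatrix_inl {n : ℕ} {R : Type*} [CommRing R] (v : ℤ × ℤ → R)
    (hv : ∀ p : ℤ × ℤ, 0 ≤ p.1 → p.1 ≤ p.2 → p.2 ≤ n → p ∉ faceSet n → v p = 0)
    (e : horizontalSet n) :
    ∑ f, (boundaryMatrix n f (Sum.inl e) : R) * v f.1 = v (e.1.1, e.1.2 + 1) - v e.1 := by
  have he := mem_horizontalSet.1 e.2
  simp only [boundaryMatrix, Sum.elim_inl]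
  push_cast
  simp only [sub_mul, Finset.sum_sub_distrib, sum_coe_ite_eq_mul]
  congr 1 <;> split_ifs with h
  · rfl
  · exact (hv _ (by dsimp only; omega) (by dsimp only; omega) (by dsimp only; omega) h).symm
  · rfl
  · exact (hv _ (by omega) (by omega) (by omega) h).symm

theorem sum_mul_boundaryMatrix_inr {n : ℕ} {R : Type*} [CommRing R] (v : ℤ × ℤ → R)
    (hv : ∀ p : ℤ × ℤ, 0 ≤ p.1 → p.1 ≤ p.2 → p.2 ≤ n → p ∉ faceSet n → v p = 0)
    (e : verticalSet n) :
    ∑ f, (boundaryMatrix n f (Sum.inr e) : R) * v f.1 = v e.1 - v (e.1.1 + 1, e.1.2) := by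
  have he := mem_verticalSet.1 e.2
  simp only [boundaryMatrix, Sum.elim_inr]
  push_cast
  simp only [sub_mul, Finset.sum_sub_distrib, sum_coe_ite_eq_mul]
  congr 1 <;> split_ifs with h
  · rfl
  · exact (hv _ (by omega) (by omega) (by omega) h).symm
  · rfl
  · exact (hv _ (by dsimp only; omega) (by dsimp only; omega) (by dsimp only; omega) h).symm

/-- The Gram matrix of the face boundaries acts as the Dirichlet Laplacian. -/
theorem sum_gram_boundaryMatrix_mul {n : ℕ} {R : Type*} [CommRing R] (v : ℤ × ℤ → R)
    (hv : ∀ p : ℤ × ℤ, 0 ≤ p.1 → p.1 ≤ p.2 → p.2 ≤ n → p ∉ faceSet n → v p = 0)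
    (f : faceSet n) :
    ∑ f', (((boundaryMatrix n * (boundaryMatrix n)ᵀ) f f' : ℤ) : R) * v f'.1 =
      4 * v f.1 - v (f.1.1 - 1, f.1.2) - v (f.1.1 + 1, f.1.2) - v (f.1.1, f.1.2 - 1)
        - v (f.1.1, f.1.2 + 1) := by
  -- These weights are the entries of Cᵀ v, so the left side becomes C (Cᵀ v).
  have h := sum_boundaryMatrix_mul f (fun p => v (p.1, p.2 + 1) - v p)
    (fun p => v p - v (p.1 + 1, p.2))
  have h2 : ∀ e, Sum.elim (fun e : horizontalSet n => v (e.1.1, e.1.2 + 1) - v e.1)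
      (fun e : verticalSet n => v e.1 - v (e.1.1 + 1, e.1.2)) e =
      ∑ f, (boundaryMatrix n f e : R) * v f.1 := by
    rintro (e | e)
    · exact (sum_mul_boundaryMatrix_inl v hv e).symm
    · exact (sum_mul_boundaryMatrix_inr v hv e).symm
  simp only [h2, Finset.mul_sum] at h
  rw [Finset.sum_comm] at h
  simp only [mul_apply, transpose_apply, Int.cast_sum, Int.cast_mul, Finset.sum_mul, mul_assoc]
  rw [h]
  simp only [sub_add_cancel]
  ring

/-- Differences around a unit square telescope. -/
theorem boundaryMatrix_mul_coboundary {n : ℕ} (f : faceSet n) (φ : vertexSet n → ℤ) :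
    ∑ e, boundaryMatrix n f e * (φ (edgeTgt n e) - φ (edgeSrc n e)) = 0 := by
  -- The default value is harmless: all values of ψ cancel in the end.
  let ψ : ℤ × ℤ → ℤ := fun p => if h : p ∈ vertexSet n then φ ⟨p, h⟩ else 0
  have hψ : ∀ p : vertexSet n, φ p = ψ p.1 := fun p => by simp [ψ]
  have h := sum_boundaryMatrix_mul f (fun p => ψ p - ψ (p.1 - 1, p.2))
    (fun p => ψ p - ψ (p.1, p.2 - 1))
  have h2 : ∀ e, φ (edgeTgt n e) - φ (edgeSrc n e) =
      Sum.elim (fun e : horizontalSet n => ψ e.1 - ψ (e.1.1 - 1, e.1.2))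
      (fun e : verticalSet n => ψ e.1 - ψ (e.1.1, e.1.2 - 1)) e := by
    rintro (e | e) <;> simp only [hψ, edgeTgt, edgeSrc, Sum.elim_inl, Sum.elim_inr]
  simp only [h2]
  simp only [Int.cast_id] at h
  rw [h]
  ring

/-- The columns of the vertical edges say that c does not change from a face to its right neighbour.
Starting from the value 0 outside column 0, this propagates along each row, over any commutative
ring. -/
theorem boundaryMatrix_row_injective {n : ℕ} {R : Type*} [CommRing R] (c : faceSet n → R)
    (hc : ∀ e, ∑ f, c f * (boundaryMatrix n f e : R) = 0) : c = 0 := by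
  let v : ℤ × ℤ → R := fun p => if h : p ∈ faceSet n then c ⟨p, h⟩ else 0
  have hv : ∀ p : faceSet n, c p = v p.1 := fun p => by simp [v]
  have hv0 : ∀ p, p ∉ faceSet n → v p = 0 := fun p h => by simp [v, h]
  have hstep : ∀ a y : ℤ, (a, y) ∈ verticalSet n → v (a + 1, y) = v (a, y) := by
    intro a y h
    have h1 := hc (Sum.inr ⟨(a, y), h⟩)
    simp only [hv, mul_comm (v _)] at h1
    rw [sum_mul_boundaryMatrix_inr v (fun p _ _ _ => hv0 p) ⟨(a, y), h⟩] at h1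
    exact (sub_eq_zero.1 h1).symm
  have hzero : ∀ (a : ℕ) (y : ℤ), v (a, y) = 0 := by
    intro a
    induction a with
    | zero =>
      intro y
      refine hv0 _ ?_
      simp [mem_faceSet]
    | succ a ih =>
      intro y
      by_cases h : ((a : ℤ), y) ∈ verticalSet n
      · push_cast
        rw [hstep _ _ h, ih]
      · refine hv0 _ fun h' => h ?_
        rw [mem_verticalSet]
        rw [mem_faceSet] at h'
        push_cast at h' ⊢
        omega
  funext ⟨⟨x, y⟩, hf⟩
  have hx := (mem_faceSet.1 hf).1
  rw [hv]
  lift x to ℕ using by dsimp only at hx; omega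
  exact hzero x y

theorem spanningTreeCount_QAD_eq_det {n : ℕ} (hn : 1 ≤ n) :
    (spanningTreeCount (QAD n) : ℤ) = (boundaryMatrix n * (boundaryMatrix n)ᵀ).det := by
  classical
  let _ : Fintype (southeastQuarter n) := Fintype.ofEquiv _ (vertexEquiv n)
  refine spanningTreeCount_eq_det (src := vertexEquiv n ∘ edgeSrc n)
    (tgt := vertexEquiv n ∘ edgeTgt n) (QAD_connected hn) ?_ ?_ ?_ ?_ ?_ ?_
  · intro u v
    obtain ⟨p, rfl⟩ := (vertexEquiv n).surjective u
    obtain ⟨q, rfl⟩ := (vertexEquiv n).surjective v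
    rw [adj_iff_exists_edge]
    simp
  · intro e h
    exact edgeSrc_ne_edgeTgt e ((vertexEquiv n).injective h)
  · intro e e' h
    refine edge_injective n (Sym2.map.injective (vertexEquiv n).injective ?_)
    simpa using h
  · rw [← Fintype.card_congr (vertexEquiv n)]
    simp only [Fintype.card_sum, Fintype.card_coe]
    exact card_faceSet_add_card_vertexSet hn
  · intro f φ
    exact boundaryMatrix_mul_coboundary f (φ ∘ vertexEquiv n)
  · intro p _ c hc
    exact boundaryMatrix_row_injective c hc

end Quarter

/-! ### Diagonalization of the Dirichlet Laplacian by antisymmetric sine products. -/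

section Spectrum

open Matrix

/-- The discrete sine wave of frequency `j` on the path `0, 1, …, n`. -/
noncomputable def sineWave (n : ℕ) (j x : ℤ) : ℝ :=
  Real.sin (x * (j * Real.pi / n))

@[simp]
theorem sineWave_zero (n : ℕ) (j : ℤ) : sineWave n j 0 = 0 := by
  simp [sineWave]

theorem sineWave_self {n : ℕ} (hn : 1 ≤ n) (j : ℤ) : sineWave n j n = 0 := by
  have h : ((n : ℤ) : ℝ) * (j * Real.pi / n) = j * Real.pi := by
    have : (n : ℝ) ≠ 0 := by positivity
    push_cast
    field_simp
  rw [sineWave, h, Real.sin_int_mul_pi]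

theorem sineWave_add_sineWave (n : ℕ) (j x : ℤ) :
    sineWave n j (x - 1) + sineWave n j (x + 1) =
      2 * Real.cos (j * Real.pi / n) * sineWave n j x := by
  simp only [sineWave]
  push_cast
  rw [sub_mul, add_mul, one_mul, Real.sin_sub, Real.sin_add]
  ring

theorem sum_Icc_int_telescope {R : Type*} [CommRing R] {n : ℕ} (hn : 1 ≤ n) (W : ℤ → R) :
    ∑ x ∈ Finset.Icc 1 ((n : ℤ) - 1), (W (x + 1) - W x) = W n - W 1 := by
  induction n, hn using Nat.le_induction with
  | base => simp
  | succ n hn ih =>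
    have h : Finset.Icc 1 (((n + 1 : ℕ) : ℤ) - 1) =
        insert (n : ℤ) (Finset.Icc 1 ((n : ℤ) - 1)) := by
      ext x
      simp only [Finset.mem_insert, Finset.mem_Icc]
      omega
    rw [h, Finset.sum_insert (by simp), ih]
    push_cast
    ring

/-- The inner product of two sine waves. -/
noncomputable def sineInner (n : ℕ) (j k : ℤ) : ℝ :=
  ∑ x ∈ Finset.Icc 1 ((n : ℤ) - 1), sineWave n j x * sineWave n k x

theorem freq_mem {n : ℕ} {j : ℤ} (hj : 1 ≤ j) (hj' : j ≤ n - 1) :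
    0 < (j : ℝ) * Real.pi / n ∧ (j : ℝ) * Real.pi / n < Real.pi := by
  have hn : (0 : ℝ) < n := by
    have : 0 < n := by omega
    exact_mod_cast this
  have h1 : (0 : ℝ) < j := by
    have : 0 < j := by omega
    exact_mod_cast this
  have h2 : (j : ℝ) < n := by
    have : j < n := by omega
    exact_mod_cast this
  refine ⟨by positivity, ?_⟩
  rw [div_lt_iff₀ hn, mul_comm]
  exact mul_lt_mul_of_pos_left h2 Real.pi_pos

theorem sineInner_self_pos {n : ℕ} {j : ℤ} (hj : 1 ≤ j) (hj' : j ≤ n - 1) :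
    0 < sineInner n j j := by
  refine Finset.sum_pos' (fun x _ => mul_self_nonneg _) ⟨1, ?_, ?_⟩
  · rw [Finset.mem_Icc]
    omega
  · obtain ⟨h1, h2⟩ := freq_mem hj hj'
    have : 0 < sineWave n j 1 := by
      simpa [sineWave] using Real.sin_pos_of_pos_of_lt_pi h1 h2
    exact mul_pos this this

/-- Discrete Green identity: the difference of eigenvalues times the inner product telescopes to a
Wronskian at the ends, where both waves vanish. The eigenvalues differ since cosine is injective on
[0, π]. -/
theorem sineInner_eq_zero {n : ℕ} {j k : ℤ} (hj : 1 ≤ j) (hj' : j ≤ n - 1) (hk : 1 ≤ k)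
    (hk' : k ≤ n - 1) (hjk : j ≠ k) : sineInner n j k = 0 := by
  have hn : 1 ≤ n := by omega
  have htel := sum_Icc_int_telescope hn fun x =>
    sineWave n j x * sineWave n k (x - 1) - sineWave n j (x - 1) * sineWave n k x
  simp only [sineWave_self hn, sub_self, sineWave_zero, mul_zero, zero_mul,
    add_sub_cancel_right] at htel
  have hmul : (2 * Real.cos (j * Real.pi / n) - 2 * Real.cos (k * Real.pi / n)) *
      sineInner n j k = 0 := by
    rw [sineInner, Finset.mul_sum, ← htel]
    refine Finset.sum_congr rfl fun x _ => ?_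
    linear_combination (-sineWave n k x) * sineWave_add_sineWave n j x +
      sineWave n j x * sineWave_add_sineWave n k x
  refine (mul_eq_zero.1 hmul).resolve_left fun h => hjk ?_
  obtain ⟨h1, h2⟩ := freq_mem hj hj'
  obtain ⟨h3, h4⟩ := freq_mem hk hk'
  have heq := Real.injOn_cos ⟨h1.le, h2.le⟩ ⟨h3.le, h4.le⟩ (by linarith)
  have hn' : (n : ℝ) ≠ 0 := by positivity
  field_simp at heq
  exact_mod_cast heq

/-- The antisymmetric product of two sine waves. -/
noncomputable def sineMinor (n : ℕ) (j p : ℤ × ℤ) : ℝ :=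
  sineWave n j.1 p.1 * sineWave n j.2 p.2 - sineWave n j.1 p.2 * sineWave n j.2 p.1

/-- Passing from the triangle to the full square makes sums of products of sine waves factor. -/
theorem two_mul_sum_faceSet {n : ℕ} (g : ℤ → ℤ → ℝ) (hsymm : ∀ x y, g x y = g y x)
    (hdiag : ∀ x, g x x = 0) :
    2 * ∑ p ∈ faceSet n, g p.1 p.2 =
      ∑ x ∈ Finset.Icc 1 ((n : ℤ) - 1), ∑ y ∈ Finset.Icc 1 ((n : ℤ) - 1), g x y := by
  set I := Finset.Icc 1 ((n : ℤ) - 1) with hI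
  have h1 : ∑ p ∈ faceSet n, g p.1 p.2 = ∑ x ∈ I, ∑ y ∈ I, if x < y then g x y else 0 := by
    rw [faceSet, Finset.sum_filter, Finset.sum_product]
  have h2 : ∑ p ∈ faceSet n, g p.1 p.2 = ∑ x ∈ I, ∑ y ∈ I, if y < x then g x y else 0 := by
    rw [h1, Finset.sum_comm]
    simp only [hsymm]
  rw [two_mul]
  nth_rewrite 1 [h1]
  rw [h2]
  simp only [← Finset.sum_add_distrib]
  refine Finset.sum_congr rfl fun x _ => Finset.sum_congr rfl fun y _ => ?_
  rcases lt_trichotomy x y with h | rfl | h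
  · simp [h, h.not_gt]
  · simp [hdiag]
  · simp [h, h.not_gt]

/-- The Cauchy–Binet formula for 2 × 2 minors. -/
theorem sum_sineMinor_mul_sineMinor (n : ℕ) (j k : ℤ × ℤ) :
    ∑ p ∈ faceSet n, sineMinor n j p * sineMinor n k p =
      sineInner n j.1 k.1 * sineInner n j.2 k.2 - sineInner n j.1 k.2 * sineInner n j.2 k.1 := by
  have h := two_mul_sum_faceSet (n := n)
    (fun x y => sineMinor n j (x, y) * sineMinor n k (x, y))
    (fun x y => by simp only [sineMinor]; ring) (fun x => by simp only [sineMinor]; ring)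
  refine mul_left_cancel₀ (two_ne_zero (α := ℝ)) (h.trans ?_)
  have hexp : ∀ x y, sineMinor n j (x, y) * sineMinor n k (x, y) =
      (sineWave n j.1 x * sineWave n k.1 x) * (sineWave n j.2 y * sineWave n k.2 y) -
      (sineWave n j.1 x * sineWave n k.2 x) * (sineWave n j.2 y * sineWave n k.1 y) -
      (sineWave n j.2 x * sineWave n k.1 x) * (sineWave n j.1 y * sineWave n k.2 y) +
      (sineWave n j.2 x * sineWave n k.2 x) * (sineWave n j.1 y * sineWave n k.1 y) := by
    intro x y
    simp only [sineMinor]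
    ring
  simp only [hexp, Finset.sum_add_distrib, Finset.sum_sub_distrib, ← Finset.sum_mul_sum,
    sineInner]
  ring

/-- The matrix whose columns are the eigenvectors of the Dirichlet Laplacian of the faces. -/
noncomputable def sineMinorMatrix (n : ℕ) : Matrix (faceSet n) (faceSet n) ℝ :=
  fun p j => sineMinor n j.1 p.1

theorem det_sineMinorMatrix_ne_zero (n : ℕ) : (sineMinorMatrix n).det ≠ 0 := by
  have hdiag : (sineMinorMatrix n)ᵀ * sineMinorMatrix n =
      diagonal fun j => sineInner n j.1.1 j.1.1 * sineInner n j.1.2 j.1.2 := by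
    ext ⟨⟨a, b⟩, hj⟩ ⟨⟨c, d⟩, hk⟩
    have hj' := mem_faceSet.1 hj
    have hk' := mem_faceSet.1 hk
    dsimp only at hj' hk'
    rw [mul_apply]
    simp only [transpose_apply, sineMinorMatrix]
    rw [Finset.sum_coe_sort (faceSet n) fun p => sineMinor n (a, b) p * sineMinor n (c, d) p,
      sum_sineMinor_mul_sineMinor, diagonal_apply]
    dsimp only
    -- If a = d then c < d = a < b, so b ≠ c; one factor always vanishes by orthogonality.
    have hcross : sineInner n a d * sineInner n b c = 0 := by
      by_cases had : a = d
      · rw [sineInner_eq_zero (j := b) (k := c) (by omega) (by omega) (by omega) (by omega)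
          (by omega), mul_zero]
      · rw [sineInner_eq_zero (by omega) (by omega) (by omega) (by omega) had, zero_mul]
    rw [hcross, sub_zero]
    split_ifs with h
    · simp only [Subtype.mk.injEq, Prod.mk.injEq] at h
      rw [h.1, h.2]
    · simp only [Subtype.mk.injEq, Prod.mk.injEq] at h
      by_cases hac : a = c
      · rw [sineInner_eq_zero (j := b) (k := d) (by omega) (by omega) (by omega) (by omega)
          (by omega), mul_zero]
      · rw [sineInner_eq_zero (by omega) (by omega) (by omega) (by omega) hac, zero_mul]
  intro h0
  have hdet := congrArg det hdiag
  rw [det_mul, h0, mul_zero, det_diagonal] at hdet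
  refine (Finset.prod_pos fun j _ => ?_).ne hdet
  have hj := mem_faceSet.1 j.2
  exact mul_pos (sineInner_self_pos (by omega) (by omega)) (sineInner_self_pos (by omega) (by omega))

/-- Both products are eigenfunctions in each variable separately, and the total eigenvalue is
symmetric in the two frequencies, so it survives antisymmetrization. -/
theorem sineMinor_laplacian (n : ℕ) (j : ℤ × ℤ) (x y : ℤ) :
    4 * sineMinor n j (x, y) - sineMinor n j (x - 1, y) - sineMinor n j (x + 1, y) -
        sineMinor n j (x, y - 1) - sineMinor n j (x, y + 1) =
      sineMinor n j (x, y) *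
        (4 - 2 * Real.cos (j.1 * Real.pi / n) - 2 * Real.cos (j.2 * Real.pi / n)) := by
  simp only [sineMinor]
  linear_combination (-sineWave n j.2 y) * sineWave_add_sineWave n j.1 x
    + sineWave n j.1 y * sineWave_add_sineWave n j.2 x
    - sineWave n j.1 x * sineWave_add_sineWave n j.2 y
    + sineWave n j.2 x * sineWave_add_sineWave n j.1 y

/-- The sides x = 0 and y = n are zeros of the waves; the diagonal is killed by antisymmetry. -/
theorem sineMinor_eq_zero {n : ℕ} (hn : 1 ≤ n) (j : ℤ × ℤ) {p : ℤ × ℤ} (h0 : 0 ≤ p.1)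
    (h1 : p.1 ≤ p.2) (h2 : p.2 ≤ n) (hp : p ∉ faceSet n) : sineMinor n j p = 0 := by
  obtain ⟨x, y⟩ := p
  rw [mem_faceSet] at hp
  dsimp only at h0 h1 h2 hp
  have : x = 0 ∨ x = y ∨ y = n := by omega
  rcases this with rfl | rfl | rfl
  · simp [sineMinor]
  · simp only [sineMinor]
    ring
  · simp [sineMinor, sineWave_self hn]

theorem det_gram_boundaryMatrix {n : ℕ} (hn : 1 ≤ n) :
    ((boundaryMatrix n * (boundaryMatrix n)ᵀ).det : ℝ) =
      ∏ j ∈ faceSet n,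
        (4 - 2 * Real.cos (j.1 * Real.pi / n) - 2 * Real.cos (j.2 * Real.pi / n)) := by
  set L := (boundaryMatrix n * (boundaryMatrix n)ᵀ).map (Int.cast : ℤ → ℝ) with hL
  -- The eigenvector equations in matrix form; comparing determinants and cancelling that of the
  -- invertible eigenvector matrix gives the product.
  have hmul : L * sineMinorMatrix n = sineMinorMatrix n * diagonal fun j =>
      (4 - 2 * Real.cos (j.1.1 * Real.pi / n) - 2 * Real.cos (j.1.2 * Real.pi / n)) := by
    ext f j
    rw [mul_diagonal, mul_apply]
    exact (sum_gram_boundaryMatrix_mul (sineMinor n j.1)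
      (fun p h0 h1 h2 hp => sineMinor_eq_zero hn _ h0 h1 h2 hp) f).trans
      (sineMinor_laplacian n j.1 f.1.1 f.1.2)
  have hdet := congrArg det hmul
  rw [det_mul, det_mul, mul_comm, det_diagonal] at hdet
  have hL' : L.det = ((boundaryMatrix n * (boundaryMatrix n)ᵀ).det : ℝ) :=
    ((Int.castRingHom ℝ).map_det _).symm
  rw [← hL', mul_left_cancel₀ (det_sineMinorMatrix_ne_zero n) hdet]
  exact Finset.prod_coe_sort (faceSet n) fun j =>
    (4 - 2 * Real.cos (j.1 * Real.pi / n) - 2 * Real.cos (j.2 * Real.pi / n))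

end Spectrum

theorem corollary2p3 (n : ℕ) (hn : 1 ≤ n) :
    (spanningTreeCount (QAD n) : ℝ) =
      ∏ p ∈ (Finset.Icc 1 (n - 1) ×ˢ Finset.Icc 1 (n - 1)).filter (fun p => p.1 < p.2),
        (4 - 2 * Real.cos (p.1 * Real.pi / n) - 2 * Real.cos (p.2 * Real.pi / n)) := by
  have h := congrArg (Int.cast : ℤ → ℝ) (spanningTreeCount_QAD_eq_det hn)
  rw [det_gram_boundaryMatrix hn, Int.cast_natCast] at h
  rw [h]
  symm
  refine Finset.prod_bij (fun p _ => ((p.1 : ℤ), (p.2 : ℤ))) ?_ ?_ ?_ ?_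
  · rintro ⟨a, b⟩ hp
    simp only [Finset.mem_filter, Finset.mem_product, Finset.mem_Icc] at hp
    rw [mem_faceSet]
    dsimp only
    omega
  · rintro ⟨a, b⟩ _ ⟨c, d⟩ _ h
    simpa using h
  · rintro ⟨a, b⟩ hp
    rw [mem_faceSet] at hp
    dsimp only at hp
    lift a to ℕ using by omega
    lift b to ℕ using by omega
    refine ⟨(a, b), ?_, rfl⟩
    simp only [Finset.mem_filter, Finset.mem_product, Finset.mem_Icc]
    omega
  · rintro ⟨a, b⟩ _
    simp
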